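/- All Hilbert spaces are finite dimensional, and operators are identified with complex matrices. A density matrix is a positive semidefinite matrix of trace $1$. The von Neumann entropy is $S(\rho)=-\operatorname{Tr}\rho\log\rho$, and for positive semidefinite $A,B$ with $\ker B\subseteq\ker A$ the relative entropy is $H(A,B)=\operatorname{Tr}(A\log A-A\log B)$ (natural logarithm, taken on the support, so $0\log 0=0$). For a matrix $P_{12}$ on $\mathcal H_1\otimes\mathcal H_2$ let $P_1=\operatorname{Tr}_2P_{12}$ and $P_2=\operatorname{Tr}_1P_{12}$ denote its partial traces, and similarly for three tensor factors. For $d\ge 1$ let $X,Z\in M_d(\mathbb C)$ be the Weyl–Heisenberg matrices with entries $x_{jk}=\delta_{j+1,k}$ ($j+1$ taken mod $d$) and $z_{jk}=\omega^j\delta_{jk}$, where $0\le j,k\le d-1$ and $\omega=e^{2\pi i/d}$. Then: 1. (Joint convexity) The set of pairs $(A,B)$ of positive semidefinite matrices of a fixed size with $\ker B\subseteq\ker A$ is convex, and $(A,B)\mapsto H(A,B)$ is jointly convex on it. 2. (Twirling identities) For every $d\ge1$, $X$ and $Z$ are unitary, and for every $P\in M_d(\mathbb C)$ $$\sum_{m,n=0}^{d-1}X^mZ^nPZ^{-n}X^{-m}=d\,(\operatorname{Tr}P)\,I.$$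 If $\dim\mathcal H_2=d$ and $U_{mn}=I_1\otimes X^mZ^n$, then each $U_{mn}$ is unitary, and for every matrix $P_{12}$ on $\mathcal H_1\otimes\mathcal H_2$ $$\frac1{d^2}\sum_{m,n=0}^{d-1}U_{mn}P_{12}U_{mn}^*=\frac1d\,P_1\otimes I_2 .$$ 3. (Monotonicity under partial trace) For all density matrices $\rho_{12},\gamma_{12}$ on $\mathcal H_1\otimes\mathcal H_2$ with $\ker\gamma_{12}\subseteq\ker\rho_{12}$, one has $\ker\gamma_1\subseteq\ker\rho_1$ and $$H(\rho_1,\gamma_1)\le H(\rho_{12},\gamma_{12}).$$ 4. (Strong subadditivity) For every density matrix $\rho_{123}$ on $\mathcal H_1\otimes\mathcal H_2\otimes\mathcal H_3$, $$S(\rho_{123})+S(\rho_2)\le S(\rho_{12})+S(\rho_{23}).$$ -/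

import Mathlib

open scoped Kronecker ComplexOrder

namespace QEntropy

/-- A density matrix (mixed state): positive semidefinite with trace one. -/
structure IsDensity {n : Type*} [Fintype n] (ρ : Matrix n n ℂ) : Prop where
  posSemidef : ρ.PosSemidef
  trace_eq_one : ρ.trace = 1

/-- The inclusion `ker γ ⊆ ker ρ`. -/
def KerLE {n : Type*} [Fintype n] (γ ρ : Matrix n n ℂ) : Prop :=
  LinearMap.ker γ.mulVecLin ≤ LinearMap.ker ρ.mulVecLin

/-- The logarithm of a positive semidefinite matrix through the functional calculus. Since
`Real.log 0 = 0`, it is the logarithm on the support and zero on the kernel, which gives the usual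
convention `0 log 0 = 0` in the two entropies below. -/
noncomputable def matLog {n : Type*} [Fintype n] [DecidableEq n] (A : Matrix n n ℂ) :
    Matrix n n ℂ :=
  cfc Real.log A

/-- The von Neumann entropy `S(ρ) = - Tr ρ log ρ`. -/
noncomputable def entropy {n : Type*} [Fintype n] [DecidableEq n] (ρ : Matrix n n ℂ) : ℝ :=
  -(ρ * matLog ρ).trace.re

/-- The relative entropy `H(ρ, γ) = Tr (ρ log ρ - ρ log γ)`, meaningful for positive semidefinite
`ρ`, `γ` with `ker γ ⊆ ker ρ`. -/
noncomputable def relEntropy {n : Type*} [Fintype n] [DecidableEq n] (ρ γ : Matrix n n ℂ) : ℝ :=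
  (ρ * matLog ρ - ρ * matLog γ).trace.re

/-- The partial trace over the second (right) tensor factor. -/
def traceRight {m n : Type*} [Fintype n] (P : Matrix (m × n) (m × n) ℂ) : Matrix m m ℂ :=
  Matrix.of fun i j => ∑ k, P (i, k) (j, k)

/-- The partial trace over the first (left) tensor factor. -/
def traceLeft {m n : Type*} [Fintype m] (P : Matrix (m × n) (m × n) ℂ) : Matrix n n ℂ :=
  Matrix.of fun i j => ∑ k, P (k, i) (k, j)

/-- The partial trace over the third factor of `H₁ ⊗ (H₂ ⊗ H₃) = (H₁ ⊗ H₂) ⊗ H₃`. -/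
def traceThird {l m n : Type*} [Fintype n] (P : Matrix (l × m × n) (l × m × n) ℂ) :
    Matrix (l × m) (l × m) ℂ :=
  traceRight (P.reindex (Equiv.prodAssoc l m n).symm (Equiv.prodAssoc l m n).symm)

/-- The cyclic shift matrix `X`, with entries `x_{jk} = δ_{j+1,k}`, where `j + 1` is mod `d`. -/
def weylX (d : ℕ) : Matrix (Fin d) (Fin d) ℂ :=
  Matrix.of fun j k => if ((j : ℕ) + 1) % d = (k : ℕ) then 1 else 0

/-- The clock matrix `Z`, with entries `z_{jk} = ω ^ j δ_{jk}`, where `ω = exp (2πi/d)`. -/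
noncomputable def weylZ (d : ℕ) : Matrix (Fin d) (Fin d) ℂ :=
  Matrix.diagonal fun j => Complex.exp (2 * Real.pi * Complex.I / d) ^ (j : ℕ)

/-- The matrix `U_{mn} = I ⊗ X^m Z^n`. -/
noncomputable def weylU (l : Type*) [DecidableEq l] (d m n : ℕ) :
    Matrix (l × Fin d) (l × Fin d) ℂ :=
  (1 : Matrix l l ℂ) ⊗ₖ (weylX d ^ m * weylZ d ^ n)

end QEntropy

/-! Everything about relative entropy comes from one variational formula. Integrating a scalar
identity over pairs of eigenvalues `aᵢ` of `A` and `bⱼ` of `B`, weighted by squared overlaps of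
eigenvectors, gives (`relEntropy_eq_integral`) H(A,B) = Tr A - Tr B + ∫₀¹ s Q_s(A,B) ds, with Q_s =
`relQuad`. For 0 < s < 1, Q_s is the maximum over matrices X of `relForm s X A B`, which is
real-linear in (A,B): `relForm_le_relQuad` gives the bound and `exists_relForm_eq_relQuad` its
attainment.

A maximum of linear functionals is convex, which gives joint convexity. A test matrix X for the
partial traces becomes the test matrix X ⊗ 1 for the full pair with the same value
(`relForm_traceRight`), which gives monotonicity directly, without the twirl and for unnormalised
matrices. Strong subadditivity is monotonicity under tracing out the third factor, applied to ρ₁₂₃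
and the unnormalised 1 ⊗ ρ₂₃.

The twirling identities are separate: summing over powers of Z is character orthogonality and kills
off-diagonal entries; summing over powers of X then spreads the trace along the diagonal. -/

namespace QEntropy

open Matrix MeasureTheory

/-! ### Scalar identities and inequalities. -/

section Scalar

/-- The integral representation of the scalar relative entropy. -/
theorem scalar_relEntropy_integral {a b : ℝ} (ha : 0 ≤ a) (hb : 0 ≤ b) (h : b = 0 → a = 0) :
    IntervalIntegrable (fun s : ℝ => s * ((a - b) ^ 2 / ((1 - s) * a + s * b))) volume 0 1 ∧
    ∫ s in (0 : ℝ)..1, s * ((a - b) ^ 2 / ((1 - s) * a + s * b)) =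
      a * Real.log a - a * Real.log b - a + b := by
  rcases hb.eq_or_lt with rfl | hb
  · simp [h rfl]
  rcases ha.eq_or_lt with rfl | ha
  -- For `a = 0` the integrand is the constant `b` except at `s = 0`, where division by zero yields
  -- 0; that point is null.
  · have hc : ∀ s : ℝ, s * ((0 - b) ^ 2 / ((1 - s) * 0 + s * b)) = if s = 0 then 0 else b := by
      intro s
      split_ifs with hs
      · simp [hs]
      · field_simp
        ring
    have hae : (fun _ : ℝ => b) =ᵐ[volume.restrict (Set.uIoc 0 1)]
        fun s : ℝ => s * ((0 - b) ^ 2 / ((1 - s) * 0 + s * b)) := by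
      refine (ae_restrict_iff' measurableSet_uIoc).2 (.of_forall fun s hs => ?_)
      rw [Set.uIoc_of_le zero_le_one] at hs
      simp only [hc, hs.1.ne', if_false]
    refine ⟨intervalIntegrable_const.congr_ae hae, ?_⟩
    rw [← intervalIntegral.integral_congr_ae_restrict hae]
    simp
  have hD : ∀ s ∈ Set.Icc (0 : ℝ) 1, 0 < (1 - s) * a + s * b := by
    intro s hs
    rcases hs.1.eq_or_lt with rfl | hs0
    · simpa using ha
    · have := mul_nonneg (sub_nonneg.2 hs.2) ha.le
      have := mul_pos hs0 hb
      linarith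
  have hint : IntervalIntegrable
      (fun s : ℝ => s * ((a - b) ^ 2 / ((1 - s) * a + s * b))) volume 0 1 := by
    apply ContinuousOn.intervalIntegrable
    rw [Set.uIcc_of_le zero_le_one]
    exact continuousOn_id.mul (continuousOn_const.div (by fun_prop) fun s hs => (hD s hs).ne')
  refine ⟨hint, ?_⟩
  rw [intervalIntegral.integral_eq_sub_of_hasDerivAt
    (f := fun s => s * (b - a) - a * Real.log ((1 - s) * a + s * b)) _ hint]
  · simp
    ring
  · intro s hs
    rw [Set.uIcc_of_le zero_le_one] at hs
    have hd := (hD s hs).ne'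
    have h1 : HasDerivAt (fun s : ℝ => (1 - s) * a + s * b) (-1 * a + 1 * b) s :=
      (((hasDerivAt_id s).const_sub 1).mul_const a).add ((hasDerivAt_id s).mul_const b)
    have h2 := ((hasDerivAt_id s).mul_const (b - a)).sub ((h1.log hd).const_mul a)
    refine h2.congr_deriv ?_
    generalize hDs : (1 - s) * a + s * b = D at hd
    field_simp
    rw [← hDs]
    ring

/-- Completing the square. -/
theorem two_re_mul_sub_le {x w : ℂ} {k D : ℝ} (hD : 0 < D) :
    2 * (star x * w).re * k - D * Complex.normSq x ≤ Complex.normSq w * (k ^ 2 / D) := by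
  rw [mul_div_assoc', le_div_iff₀ hD]
  simp only [Complex.normSq_apply, Complex.mul_re, Complex.star_def, Complex.conj_re,
    Complex.conj_im]
  nlinarith [sq_nonneg (D * x.re - k * w.re), sq_nonneg (D * x.im - k * w.im)]

end Scalar

/-! ### Spectral sums and the variational formula. -/

section Spectral

variable {n : Type*} [Fintype n] [DecidableEq n] {A B : Matrix n n ℂ}

theorem cfc_eq_unitary_conj (hA : A.IsHermitian) (f : ℝ → ℝ) :
    cfc f A = (hA.eigenvectorUnitary : Matrix n n ℂ) *
      diagonal (fun i => (f (hA.eigenvalues i) : ℂ)) *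
        (hA.eigenvectorUnitary : Matrix n n ℂ)ᴴ := by
  rw [hA.cfc_eq, IsHermitian.cfc, Unitary.conjStarAlgAut_apply]
  rfl

theorem eq_unitary_conj (hA : A.IsHermitian) :
    A = (hA.eigenvectorUnitary : Matrix n n ℂ) *
      diagonal (fun i => (hA.eigenvalues i : ℂ)) *
        (hA.eigenvectorUnitary : Matrix n n ℂ)ᴴ := by
  simpa [cfc_id' ℝ A hA.isSelfAdjoint] using cfc_eq_unitary_conj hA (fun x => x)

theorem conjTranspose_mul_eigenvectorUnitary (hA : A.IsHermitian) :
    (hA.eigenvectorUnitary : Matrix n n ℂ)ᴴ * hA.eigenvectorUnitary = 1 :=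
  mem_unitaryGroup_iff'.1 hA.eigenvectorUnitary.2

theorem eigenvectorUnitary_mul_conjTranspose (hA : A.IsHermitian) :
    (hA.eigenvectorUnitary : Matrix n n ℂ) * (hA.eigenvectorUnitary : Matrix n n ℂ)ᴴ = 1 :=
  mem_unitaryGroup_iff.1 hA.eigenvectorUnitary.2

/-- The matrix of inner products of the eigenvectors of `A` and of `B`. -/
noncomputable def overlap (hA : A.IsHermitian) (hB : B.IsHermitian) : Matrix n n ℂ :=
  (hA.eigenvectorUnitary : Matrix n n ℂ)ᴴ * hB.eigenvectorUnitary

theorem trace_cfc_mul_cfc (hA : A.IsHermitian) (hB : B.IsHermitian) (f g : ℝ → ℝ) :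
    (cfc f A * cfc g B).trace.re = ∑ i, ∑ j, Complex.normSq (overlap hA hB i j) *
      (f (hA.eigenvalues i) * g (hB.eigenvalues j)) := by
  have h : (cfc f A * cfc g B).trace = (diagonal (fun i => (f (hA.eigenvalues i) : ℂ)) *
      (overlap hA hB * diagonal (fun i => (g (hB.eigenvalues i) : ℂ)) *
        (overlap hA hB)ᴴ)).trace := by
    rw [cfc_eq_unitary_conj hA, cfc_eq_unitary_conj hB, overlap]
    simp only [conjTranspose_mul, conjTranspose_conjTranspose, Matrix.mul_assoc]
    rw [trace_mul_comm]
    simp only [Matrix.mul_assoc]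
  rw [h]
  simp only [trace, diag, diagonal_mul, mul_apply (M := overlap hA hB * _), mul_diagonal,
    conjTranspose_apply, Complex.re_sum, Finset.mul_sum]
  refine Finset.sum_congr rfl fun i _ => Finset.sum_congr rfl fun j _ => ?_
  simp only [Complex.normSq_apply, Complex.mul_re, Complex.mul_im, Complex.star_def,
    Complex.conj_re, Complex.conj_im, Complex.ofReal_re, Complex.ofReal_im]
  ring

/-- The quadratic form `∑ |⟨aᵢ, bⱼ⟩|² (aᵢ - bⱼ)² / ((1 - s) aᵢ + s bⱼ)`. -/
noncomputable def relQuad (s : ℝ) (hA : A.IsHermitian) (hB : B.IsHermitian) : ℝ :=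
  ∑ i, ∑ j, Complex.normSq (overlap hA hB i j) *
    ((hA.eigenvalues i - hB.eigenvalues j) ^ 2 /
      ((1 - s) * hA.eigenvalues i + s * hB.eigenvalues j))

/-- The real-linear functional of `(A, B)` whose maximum over `X` is `relQuad`. -/
noncomputable def relForm {m : Type*} [Fintype m] (s : ℝ) (X A B : Matrix m m ℂ) : ℝ :=
  2 * (Xᴴ * (A - B)).trace.re - (1 - s) * (Xᴴ * A * X).trace.re - s * (X * B * Xᴴ).trace.re

/-- Written in the eigenbasis of `A` on the left and of `B` on the right, the form decouples into
independent quadratics in the entries of `Y`, so it can be maximised entry by entry. -/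
theorem relForm_unitary_conj (s : ℝ) (hA : A.IsHermitian) (hB : B.IsHermitian)
    (Y : Matrix n n ℂ) :
    relForm s ((hA.eigenvectorUnitary : Matrix n n ℂ) * Y *
      (hB.eigenvectorUnitary : Matrix n n ℂ)ᴴ) A B =
    ∑ i, ∑ j, (2 * (star (Y i j) * overlap hA hB i j).re *
        (hA.eigenvalues i - hB.eigenvalues j) -
      ((1 - s) * hA.eigenvalues i + s * hB.eigenvalues j) * Complex.normSq (Y i j)) := by
  set U := (hA.eigenvectorUnitary : Matrix n n ℂ) with hU
  set V := (hB.eigenvectorUnitary : Matrix n n ℂ) with hV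
  have hU1 : Uᴴ * U = 1 := conjTranspose_mul_eigenvectorUnitary hA
  have hV1 : Vᴴ * V = 1 := conjTranspose_mul_eigenvectorUnitary hB
  have hU2 : ∀ M : Matrix n n ℂ, Uᴴ * (U * M) = M := fun M => by
    rw [← Matrix.mul_assoc, hU1, Matrix.one_mul]
  have hV2 : ∀ M : Matrix n n ℂ, Vᴴ * (V * M) = M := fun M => by
    rw [← Matrix.mul_assoc, hV1, Matrix.one_mul]
  set a := hA.eigenvalues
  set b := hB.eigenvalues
  have hA' : A = U * (diagonal (fun i => (a i : ℂ)) * Uᴴ) := by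
    rw [← Matrix.mul_assoc]; exact eq_unitary_conj hA
  have hB' : B = V * (diagonal (fun i => (b i : ℂ)) * Vᴴ) := by
    rw [← Matrix.mul_assoc]; exact eq_unitary_conj hB
  have hW : overlap hA hB = Uᴴ * V := rfl
  have e1 : ((U * Y * Vᴴ)ᴴ * A).trace =
      (Yᴴ * (diagonal (fun i => (a i : ℂ)) * overlap hA hB)).trace := by
    conv_lhs => rw [hA']
    simp only [conjTranspose_mul, conjTranspose_conjTranspose, Matrix.mul_assoc, hU2]
    rw [trace_mul_comm, hW]
    simp only [Matrix.mul_assoc]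
  have e2 : ((U * Y * Vᴴ)ᴴ * B).trace =
      (Yᴴ * (overlap hA hB * diagonal (fun i => (b i : ℂ)))).trace := by
    conv_lhs => rw [hB']
    simp only [conjTranspose_mul, conjTranspose_conjTranspose, Matrix.mul_assoc]
    rw [trace_mul_comm, hW]
    simp only [Matrix.mul_assoc, hV1, Matrix.mul_one]
  have e3 : ((U * Y * Vᴴ)ᴴ * A * (U * Y * Vᴴ)).trace =
      (Yᴴ * (diagonal (fun i => (a i : ℂ)) * Y)).trace := by
    conv_lhs => rw [hA']
    simp only [conjTranspose_mul, conjTranspose_conjTranspose, Matrix.mul_assoc, hU2]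
    rw [trace_mul_comm]
    simp only [Matrix.mul_assoc, hV1, Matrix.mul_one]
  have e4 : ((U * Y * Vᴴ) * B * (U * Y * Vᴴ)ᴴ).trace =
      (Yᴴ * (Y * diagonal (fun i => (b i : ℂ)))).trace := by
    conv_lhs => rw [hB']
    simp only [conjTranspose_mul, conjTranspose_conjTranspose, Matrix.mul_assoc, hV2]
    rw [trace_mul_comm]
    simp only [Matrix.mul_assoc, hU1, Matrix.mul_one]
    rw [trace_mul_comm Yᴴ]
    simp only [Matrix.mul_assoc]
  rw [relForm, Matrix.mul_sub, trace_sub, e1, e2, e3, e4]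
  have key : ∀ M : Matrix n n ℂ, (Yᴴ * M).trace.re = ∑ i, ∑ j, (star (Y i j) * M i j).re := by
    intro M
    simp only [trace, diag, mul_apply, conjTranspose_apply, Complex.re_sum]
    exact Finset.sum_comm
  simp only [Complex.sub_re, key, diagonal_mul, mul_diagonal, ← Finset.sum_sub_distrib,
    Finset.mul_sum]
  refine Finset.sum_congr rfl fun i _ => Finset.sum_congr rfl fun j _ => ?_
  simp only [Complex.normSq_apply, Complex.mul_re, Complex.mul_im, Complex.star_def,
    Complex.conj_re, Complex.conj_im, Complex.ofReal_re, Complex.ofReal_im]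
  ring

theorem relForm_le_relQuad {s : ℝ} (hs : s ∈ Set.Ioo (0 : ℝ) 1) (hA : A.PosSemidef)
    (hB : B.PosSemidef) (X : Matrix n n ℂ) :
    relForm s X A B ≤ relQuad s hA.isHermitian hB.isHermitian := by
  have hX : X = (hA.isHermitian.eigenvectorUnitary : Matrix n n ℂ) *
      ((hA.isHermitian.eigenvectorUnitary : Matrix n n ℂ)ᴴ * X *
        hB.isHermitian.eigenvectorUnitary) *
      (hB.isHermitian.eigenvectorUnitary : Matrix n n ℂ)ᴴ := by
    simp only [← Matrix.mul_assoc, eigenvectorUnitary_mul_conjTranspose, Matrix.one_mul]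
    rw [Matrix.mul_assoc, eigenvectorUnitary_mul_conjTranspose, Matrix.mul_one]
  rw [hX, relForm_unitary_conj, relQuad]
  refine Finset.sum_le_sum fun i _ => Finset.sum_le_sum fun j _ => ?_
  have ha := hA.eigenvalues_nonneg i
  have hb := hB.eigenvalues_nonneg j
  have h1 := mul_nonneg (sub_nonneg.2 hs.2.le) ha
  have h2 := mul_nonneg hs.1.le hb
  rcases (add_nonneg h1 h2).eq_or_lt with h | h
  -- Both weights `1 - s` and `s` are positive, so a zero denominator forces both eigenvalues to
  -- vanish.
  · have h3 : hA.isHermitian.eigenvalues i = 0 := by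
      have := sub_pos.2 hs.2
      by_contra hne
      have := mul_pos this (lt_of_le_of_ne ha (Ne.symm hne))
      linarith
    have h4 : hB.isHermitian.eigenvalues j = 0 := by
      by_contra hne
      have := mul_pos hs.1 (lt_of_le_of_ne hb (Ne.symm hne))
      linarith
    simp [h3, h4]
  · exact two_re_mul_sub_le h

/-- The witness is the entrywise maximiser from completing the square; where the denominator
vanishes, `x / 0 = 0` makes both sides zero. -/
theorem exists_relForm_eq_relQuad (s : ℝ) (hA : A.IsHermitian) (hB : B.IsHermitian) :
    ∃ X, relForm s X A B = relQuad s hA hB := by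
  refine ⟨_, (relForm_unitary_conj s hA hB (Matrix.of fun i j =>
    (((hA.eigenvalues i - hB.eigenvalues j) /
      ((1 - s) * hA.eigenvalues i + s * hB.eigenvalues j) : ℝ) : ℂ) *
        overlap hA hB i j)).trans ?_⟩
  refine Finset.sum_congr rfl fun i _ => Finset.sum_congr rfl fun j _ => ?_
  by_cases h : (1 - s) * hA.eigenvalues i + s * hB.eigenvalues j = 0
  · rw [h, of_apply, h]
    simp
  · simp only [of_apply, map_mul, Complex.normSq_ofReal]
    simp only [Complex.normSq_apply, Complex.mul_re, Complex.mul_im, Complex.star_def,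
      Complex.conj_re, Complex.conj_im, Complex.ofReal_re, Complex.ofReal_im]
    field_simp
    ring

end Spectral

/-! ### Integral representation and joint convexity. -/

section Convexity

variable {n : Type*} [Fintype n] {A B : Matrix n n ℂ}

theorem KerLE.mulVec_eq_zero (h : KerLE B A) {v : n → ℂ} (hv : B *ᵥ v = 0) : A *ᵥ v = 0 :=
  h hv

theorem mulVec_eq_zero_of_dotProduct (hA : A.PosSemidef) {v : n → ℂ}
    (h : star v ⬝ᵥ A *ᵥ v = 0) : A *ᵥ v = 0 := by
  classical
  exact (hA.dotProduct_mulVec_zero_iff v).1 h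

theorem posSemidef_add_smul {p q : ℝ} (hp : 0 ≤ p) (hq : 0 ≤ q) {m : Type*} {A₁ A₂ : Matrix m m ℂ}
    (h₁ : A₁.PosSemidef) (h₂ : A₂.PosSemidef) : (p • A₁ + q • A₂).PosSemidef :=
  (h₁.smul hp).add (h₂.smul hq)

theorem relForm_add_smul (s p q : ℝ) (X A₁ B₁ A₂ B₂ : Matrix n n ℂ) :
    relForm s X (p • A₁ + q • A₂) (p • B₁ + q • B₂) =
      p * relForm s X A₁ B₁ + q * relForm s X A₂ B₂ := by
  simp only [relForm, Matrix.mul_add, Matrix.add_mul, Matrix.mul_sub, Matrix.mul_smul,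
    Matrix.smul_mul, trace_add, trace_sub, trace_smul, Complex.add_re, Complex.sub_re,
    Complex.smul_re, smul_eq_mul]
  ring

/-- On a kernel vector two nonnegative quadratic forms sum to zero, so each summand either has
weight zero or annihilates the vector. -/
theorem kerLE_add_smul {p q : ℝ} (hp : 0 ≤ p) (hq : 0 ≤ q)
    {A₁ B₁ A₂ B₂ : Matrix n n ℂ} (hB₁ : B₁.PosSemidef) (hB₂ : B₂.PosSemidef)
    (h₁ : KerLE B₁ A₁) (h₂ : KerLE B₂ A₂) : KerLE (p • B₁ + q • B₂) (p • A₁ + q • A₂) := by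
  intro v hv
  have hv' : (p • B₁ + q • B₂) *ᵥ v = 0 := hv
  have h0 : p * (star v ⬝ᵥ B₁ *ᵥ v).re + q * (star v ⬝ᵥ B₂ *ᵥ v).re = 0 := by
    have := congrArg (fun w => (star v ⬝ᵥ w).re) hv'
    simpa [add_mulVec, smul_mulVec, dotProduct_add, dotProduct_smul] using this
  have n1 := Complex.le_def.1 (hB₁.dotProduct_mulVec_nonneg v)
  have n2 := Complex.le_def.1 (hB₂.dotProduct_mulVec_nonneg v)
  have m1 := mul_nonneg hp n1.1
  have m2 := mul_nonneg hq n2.1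
  simp only [Complex.zero_re] at m1 m2 n1 n2
  have key : ∀ {r : ℝ} {A B : Matrix n n ℂ}, B.PosSemidef → KerLE B A →
      0 = (star v ⬝ᵥ B *ᵥ v).im → r * (star v ⬝ᵥ B *ᵥ v).re = 0 → r • (A *ᵥ v) = 0 := by
    intro r A B hB h him hr
    rcases mul_eq_zero.1 hr with hr | hr
    · rw [hr, zero_smul]
    · rw [h.mulVec_eq_zero (mulVec_eq_zero_of_dotProduct hB (Complex.ext hr him.symm)), smul_zero]
  have k1 := key (r := p) hB₁ h₁ n1.2 (by linarith)
  have k2 := key (r := q) hB₂ h₂ n2.2 (by linarith)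
  change (p • A₁ + q • A₂) *ᵥ v = 0
  rw [add_mulVec, smul_mulVec, smul_mulVec, k1, k2, add_zero]

variable [DecidableEq n]

/-- `A` kills the `j`-th eigenvector of `B`, and its component along the `i`-th eigenvector of `A`
is `aᵢ` times the overlap. This supplies the scalar hypothesis `b = 0 → a = 0` wherever the weight
is nonzero. -/
theorem eigenvalue_eq_zero_of_kerLE (hA : A.IsHermitian) (hB : B.IsHermitian) (h : KerLE B A)
    {i j : n} (hij : overlap hA hB i j ≠ 0) (hb : hB.eigenvalues j = 0) :
    hA.eigenvalues i = 0 := by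
  have h1 : A *ᵥ (hB.eigenvectorBasis j) = 0 := h.mulVec_eq_zero (by
    rw [hB.mulVec_eigenvectorBasis, hb, zero_smul])
  have h2 : (A * (hB.eigenvectorUnitary : Matrix n n ℂ)).col j = 0 := by
    rw [← h1]
    ext k
    simp [mul_apply, mulVec, dotProduct, IsHermitian.eigenvectorUnitary_apply]
  have h3 : diagonal (fun i => (hA.eigenvalues i : ℂ)) * overlap hA hB =
      (hA.eigenvectorUnitary : Matrix n n ℂ)ᴴ * (A * hB.eigenvectorUnitary) := by
    refine Eq.trans ?_ (congrArg (fun M => (hA.eigenvectorUnitary : Matrix n n ℂ)ᴴ *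
      (M * hB.eigenvectorUnitary)) (eq_unitary_conj hA)).symm
    simp only [← Matrix.mul_assoc, conjTranspose_mul_eigenvectorUnitary, Matrix.one_mul]
    rw [Matrix.mul_assoc, overlap]
  have h4 := congrFun (congrFun h3 i) j
  rw [diagonal_mul, mul_apply] at h4
  have h5 : ∀ k, (A * (hB.eigenvectorUnitary : Matrix n n ℂ)) k j = 0 := fun k => congrFun h2 k
  simp only [h5, mul_zero, Finset.sum_const_zero, mul_eq_zero, hij, or_false] at h4
  exact_mod_cast h4

/-- The integral representation of the relative entropy. -/
theorem relEntropy_eq_integral (hA : A.PosSemidef) (hB : B.PosSemidef) (h : KerLE B A) :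
    IntervalIntegrable (fun s => s * relQuad s hA.isHermitian hB.isHermitian) volume 0 1 ∧
    relEntropy A B = A.trace.re - B.trace.re +
      ∫ s in (0 : ℝ)..1, s * relQuad s hA.isHermitian hB.isHermitian := by
  set W := overlap hA.isHermitian hB.isHermitian with hW
  set a := hA.isHermitian.eigenvalues
  set b := hB.isHermitian.eigenvalues
  have hterm : ∀ i j, IntervalIntegrable (fun s : ℝ => Complex.normSq (W i j) *
        (s * ((a i - b j) ^ 2 / ((1 - s) * a i + s * b j)))) volume 0 1 ∧
      ∫ s in (0 : ℝ)..1, Complex.normSq (W i j) *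
        (s * ((a i - b j) ^ 2 / ((1 - s) * a i + s * b j))) =
      Complex.normSq (W i j) * (a i * Real.log (a i) - a i * Real.log (b j) - a i + b j) := by
    intro i j
    by_cases hij : W i j = 0
    · simp [hij]
    · obtain ⟨h1, h2⟩ := scalar_relEntropy_integral (hA.eigenvalues_nonneg i)
        (hB.eigenvalues_nonneg j)
        (eigenvalue_eq_zero_of_kerLE hA.isHermitian hB.isHermitian h hij)
      exact ⟨h1.const_mul _, by rw [intervalIntegral.integral_const_mul, h2]⟩
  have hfun : (fun s => s * relQuad s hA.isHermitian hB.isHermitian) =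
      fun s => ∑ i, ∑ j, Complex.normSq (W i j) *
        (s * ((a i - b j) ^ 2 / ((1 - s) * a i + s * b j))) := by
    ext s
    simp only [relQuad, Finset.mul_sum]
    refine Finset.sum_congr rfl fun i _ => Finset.sum_congr rfl fun j _ => ?_
    ring
  have hin : ∀ i, IntervalIntegrable (fun s : ℝ => ∑ j, Complex.normSq (W i j) *
      (s * ((a i - b j) ^ 2 / ((1 - s) * a i + s * b j)))) volume 0 1 := fun i => by
    simpa only [Finset.sum_fn] using IntervalIntegrable.sum Finset.univ fun j _ => (hterm i j).1
  rw [hfun]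
  refine ⟨by simpa only [Finset.sum_fn] using IntervalIntegrable.sum Finset.univ fun i _ => hin i,
    ?_⟩
  rw [intervalIntegral.integral_finsetSum fun i _ => hin i]
  simp_rw [intervalIntegral.integral_finsetSum fun j _ => (hterm _ j).1, (hterm _ _).2]
  -- Inserting the identity as `cfc 1` of the other matrix turns traces involving one matrix into
  -- the same double sums.
  have c1 : ∀ f : ℝ → ℝ, cfc f A * cfc (fun _ : ℝ => (1 : ℝ)) B = cfc f A := fun f => by
    rw [cfc_const_one ℝ B hB.isHermitian.isSelfAdjoint, Matrix.mul_one]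
  have c2 : ∀ f : ℝ → ℝ, cfc (fun _ : ℝ => (1 : ℝ)) A * cfc f B = cfc f B := fun f => by
    rw [cfc_const_one ℝ A hA.isHermitian.isSelfAdjoint, Matrix.one_mul]
  have iA : cfc (fun x : ℝ => x) A = A := cfc_id' ℝ A hA.isHermitian.isSelfAdjoint
  have iB : cfc (fun x : ℝ => x) B = B := cfc_id' ℝ B hB.isHermitian.isSelfAdjoint
  have fin : ∀ (f : ℝ → ℝ), ContinuousOn f (spectrum ℝ A) := fun f =>
    (finite_real_spectrum (A := A)).continuousOn f
  have t1 : (A * matLog A).trace.re = ∑ i, ∑ j, Complex.normSq (W i j) *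
      (a i * Real.log (a i) * 1) := by
    rw [← trace_cfc_mul_cfc hA.isHermitian hB.isHermitian (fun x => x * Real.log x) fun _ => 1, c1,
      cfc_mul _ _ A (fin _) (fin _), iA, matLog]
  have t2 : (A * matLog B).trace.re = ∑ i, ∑ j, Complex.normSq (W i j) *
      (a i * Real.log (b j)) := by
    rw [← trace_cfc_mul_cfc hA.isHermitian hB.isHermitian (fun x => x) Real.log, iA, matLog]
  have t3 : A.trace.re = ∑ i, ∑ j, Complex.normSq (W i j) * (a i * 1) := by
    rw [← trace_cfc_mul_cfc hA.isHermitian hB.isHermitian (fun x => x) fun _ => 1, c1, iA]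
  have t4 : B.trace.re = ∑ i, ∑ j, Complex.normSq (W i j) * (1 * b j) := by
    rw [← trace_cfc_mul_cfc hA.isHermitian hB.isHermitian (fun _ => 1) fun x => x, c2, iB]
  rw [relEntropy, trace_sub, Complex.sub_re, t1, t2, t3, t4]
  simp only [← Finset.sum_sub_distrib, ← Finset.sum_add_distrib]
  refine Finset.sum_congr rfl fun i _ => Finset.sum_congr rfl fun j _ => ?_
  ring

theorem relQuad_add_smul_le {s p q : ℝ} (hs : s ∈ Set.Ioo (0 : ℝ) 1) (hp : 0 ≤ p) (hq : 0 ≤ q)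
    {A₁ B₁ A₂ B₂ : Matrix n n ℂ} (hA₁ : A₁.PosSemidef) (hB₁ : B₁.PosSemidef)
    (hA₂ : A₂.PosSemidef) (hB₂ : B₂.PosSemidef)
    (hA : (p • A₁ + q • A₂).PosSemidef) (hB : (p • B₁ + q • B₂).PosSemidef) :
    relQuad s hA.isHermitian hB.isHermitian ≤
      p * relQuad s hA₁.isHermitian hB₁.isHermitian +
        q * relQuad s hA₂.isHermitian hB₂.isHermitian := by
  obtain ⟨X, hX⟩ := exists_relForm_eq_relQuad s hA.isHermitian hB.isHermitian
  rw [← hX, relForm_add_smul]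
  have := relForm_le_relQuad hs hA₁ hB₁ X
  have := relForm_le_relQuad hs hA₂ hB₂ X
  gcongr

/-- The relative entropy is jointly convex. -/
theorem convexOn_relEntropy :
    ConvexOn ℝ
      {p : Matrix n n ℂ × Matrix n n ℂ | p.1.PosSemidef ∧ p.2.PosSemidef ∧ KerLE p.2 p.1}
      (fun p => relEntropy p.1 p.2) := by
  have hset : Convex ℝ
      {p : Matrix n n ℂ × Matrix n n ℂ | p.1.PosSemidef ∧ p.2.PosSemidef ∧ KerLE p.2 p.1} :=
    fun x hx y hy p q hp hq _ => ⟨posSemidef_add_smul hp hq hx.1 hy.1,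
      posSemidef_add_smul hp hq hx.2.1 hy.2.1, kerLE_add_smul hp hq hx.2.1 hy.2.1 hx.2.2 hy.2.2⟩
  refine ⟨hset, ?_⟩
  rintro ⟨A₁, B₁⟩ hx ⟨A₂, B₂⟩ hy p q hp hq hpq
  obtain ⟨hA, hB, h⟩ := hset hx hy hp hq hpq
  obtain ⟨hA₁, hB₁, h₁⟩ := hx
  obtain ⟨hA₂, hB₂, h₂⟩ := hy
  simp only [Prod.smul_mk, Prod.mk_add_mk] at hA hB h hA₁ hB₁ h₁ hA₂ hB₂ h₂ ⊢
  obtain ⟨i, e⟩ := relEntropy_eq_integral hA hB h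
  obtain ⟨i₁, e₁⟩ := relEntropy_eq_integral hA₁ hB₁ h₁
  obtain ⟨i₂, e₂⟩ := relEntropy_eq_integral hA₂ hB₂ h₂
  have hle := intervalIntegral.integral_mono_on_of_le_Ioo zero_le_one i
    ((i₁.const_mul p).add (i₂.const_mul q)) fun s hs => by
      have := mul_le_mul_of_nonneg_left
        (relQuad_add_smul_le hs hp hq hA₁ hB₁ hA₂ hB₂ hA hB) hs.1.le
      linarith
  rw [intervalIntegral.integral_add (i₁.const_mul p) (i₂.const_mul q),
    intervalIntegral.integral_const_mul, intervalIntegral.integral_const_mul] at hle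
  rw [e, e₁, e₂]
  simp only [trace_add, trace_smul, Complex.add_re, Complex.smul_re, smul_eq_mul]
  linarith

end Convexity

/-! ### Partial traces and monotonicity. -/

section PartialTrace

variable {m n : Type*} [Fintype m] [Fintype n]

theorem trace_traceRight (P : Matrix (m × n) (m × n) ℂ) : (traceRight P).trace = P.trace := by
  simp [traceRight, trace, Fintype.sum_prod_type]

theorem trace_mul_traceRight [DecidableEq n] (X : Matrix m m ℂ) (P : Matrix (m × n) (m × n) ℂ) :
    (X * traceRight P).trace = ((X ⊗ₖ (1 : Matrix n n ℂ)) * P).trace := by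
  simp only [trace, diag, mul_apply, traceRight, of_apply, Fintype.sum_prod_type,
    kroneckerMap_apply, one_apply, mul_ite, mul_one, mul_zero, ite_mul, zero_mul,
    Finset.sum_ite_eq, Finset.mem_univ, if_true, Finset.mul_sum]
  exact Finset.sum_congr rfl fun i _ => Finset.sum_comm

theorem trace_mul_traceLeft [DecidableEq m] (X : Matrix n n ℂ) (P : Matrix (m × n) (m × n) ℂ) :
    (X * traceLeft P).trace = (((1 : Matrix m m ℂ) ⊗ₖ X) * P).trace := by
  simp only [trace, diag, mul_apply, traceLeft, of_apply, Fintype.sum_prod_type,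
    kroneckerMap_apply, one_apply, ite_mul, one_mul, zero_mul, Finset.mul_sum]
  rw [Finset.sum_comm_cycle]
  refine Finset.sum_congr rfl fun i _ => ?_
  refine Finset.sum_congr rfl fun j _ => ?_
  rw [Finset.sum_comm]
  simp

omit [Fintype m] in
theorem posSemidef_traceRight {P : Matrix (m × n) (m × n) ℂ} (hP : P.PosSemidef) :
    (traceRight P).PosSemidef := by
  have : traceRight P = ∑ k, P.submatrix (fun i => (i, k)) (fun i => (i, k)) := by
    ext i j
    simp [traceRight, Matrix.sum_apply]
  rw [this]
  exact posSemidef_sum _ fun k _ => hP.submatrix _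

omit [Fintype n] in
theorem posSemidef_traceLeft {P : Matrix (m × n) (m × n) ℂ} (hP : P.PosSemidef) :
    (traceLeft P).PosSemidef := by
  have : traceLeft P = ∑ k, P.submatrix (fun i => (k, i)) (fun i => (k, i)) := by
    ext i j
    simp [traceLeft, Matrix.sum_apply]
  rw [this]
  exact posSemidef_sum _ fun k _ => hP.submatrix _

/-- The product vector `v ⊗ e_k`. -/
def tensorBasis [DecidableEq n] (v : m → ℂ) (k : n) : m × n → ℂ :=
  fun p => if p.2 = k then v p.1 else 0

theorem mulVec_tensorBasis [DecidableEq n] {l : Type*} (P : Matrix l (m × n) ℂ) (v : m → ℂ)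
    (k : n) (p : l) : (P *ᵥ tensorBasis v k) p = ∑ i, P p (i, k) * v i := by
  simp [mulVec, dotProduct, tensorBasis, Fintype.sum_prod_type]

theorem traceRight_mulVec [DecidableEq n] (P : Matrix (m × n) (m × n) ℂ) (v : m → ℂ) (i : m) :
    (traceRight P *ᵥ v) i = ∑ k, (P *ᵥ tensorBasis v k) (i, k) := by
  simp only [mulVec_tensorBasis]
  simp only [mulVec, dotProduct, traceRight, of_apply, Finset.sum_mul]
  exact Finset.sum_comm

/-- The quadratic form of the partial trace at `v` is the sum of those of `P` at `v ⊗ e_k`;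
nonnegative terms with sum zero all vanish. -/
theorem mulVec_tensorBasis_eq_zero [DecidableEq n] {P : Matrix (m × n) (m × n) ℂ}
    (hP : P.PosSemidef) {v : m → ℂ} (hv : traceRight P *ᵥ v = 0) (k : n) :
    P *ᵥ tensorBasis v k = 0 := by
  have h1 : star v ⬝ᵥ traceRight P *ᵥ v =
      ∑ k, star (tensorBasis v k) ⬝ᵥ P *ᵥ tensorBasis v k := by
    have h2 : ∀ k (w : m × n → ℂ), star (tensorBasis v k) ⬝ᵥ w = ∑ i, star (v i) * w (i, k) := by
      intro k w
      simp [dotProduct, tensorBasis, Fintype.sum_prod_type, apply_ite star]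
    simp only [h2]
    simp only [dotProduct, traceRight_mulVec, Pi.star_apply, Finset.mul_sum]
    exact Finset.sum_comm
  rw [hv, dotProduct_zero] at h1
  exact mulVec_eq_zero_of_dotProduct hP
    ((Finset.sum_eq_zero_iff_of_nonneg fun k _ => hP.dotProduct_mulVec_nonneg _).1 h1.symm k
      (Finset.mem_univ k))

theorem kerLE_traceRight {ρ γ : Matrix (m × n) (m × n) ℂ} (hγ : γ.PosSemidef) (h : KerLE γ ρ) :
    KerLE (traceRight γ) (traceRight ρ) := by
  classical
  intro v hv
  change traceRight ρ *ᵥ v = 0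
  ext i
  rw [traceRight_mulVec]
  exact Finset.sum_eq_zero fun k _ => congrFun
    (h.mulVec_eq_zero (mulVec_tensorBasis_eq_zero hγ hv k)) (i, k)

/-- Partial trace is adjoint to `X ↦ X ⊗ 1`, which is multiplicative and respects adjoints;
cyclicity brings the quadratic terms into the form where this duality applies. -/
theorem relForm_traceRight [DecidableEq n] (s : ℝ) (X : Matrix m m ℂ)
    (A B : Matrix (m × n) (m × n) ℂ) :
    relForm s X (traceRight A) (traceRight B) =
      relForm s (X ⊗ₖ (1 : Matrix n n ℂ)) A B := by
  have hc : (X ⊗ₖ (1 : Matrix n n ℂ))ᴴ = Xᴴ ⊗ₖ 1 := by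
    rw [conjTranspose_kronecker, conjTranspose_one]
  rw [relForm, relForm, hc, Matrix.mul_sub, Matrix.mul_sub, trace_sub, trace_sub,
    trace_mul_comm (Xᴴ * _), trace_mul_comm ((Xᴴ ⊗ₖ (1 : Matrix n n ℂ)) * A),
    trace_mul_cycle X, trace_mul_cycle (X ⊗ₖ (1 : Matrix n n ℂ))]
  simp only [← Matrix.mul_assoc, trace_mul_traceRight, ← mul_kronecker_mul, Matrix.one_mul]

/-- The relative entropy does not increase under the partial trace. -/
theorem relEntropy_traceRight_le [DecidableEq m] [DecidableEq n]
    {ρ γ : Matrix (m × n) (m × n) ℂ} (hρ : ρ.PosSemidef) (hγ : γ.PosSemidef) (h : KerLE γ ρ) :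
    relEntropy (traceRight ρ) (traceRight γ) ≤ relEntropy ρ γ := by
  obtain ⟨i, e⟩ := relEntropy_eq_integral hρ hγ h
  obtain ⟨i₁, e₁⟩ := relEntropy_eq_integral (posSemidef_traceRight hρ) (posSemidef_traceRight hγ)
    (kerLE_traceRight hγ h)
  rw [e, e₁, trace_traceRight, trace_traceRight]
  refine add_le_add_right (intervalIntegral.integral_mono_on_of_le_Ioo zero_le_one i₁ i
    fun s hs => mul_le_mul_of_nonneg_left ?_ hs.1.le) _
  obtain ⟨X, hX⟩ := exists_relForm_eq_relQuad s (posSemidef_traceRight hρ).isHermitian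
    (posSemidef_traceRight hγ).isHermitian
  rw [← hX, relForm_traceRight]
  exact relForm_le_relQuad hs hρ hγ _

end PartialTrace

/-! ### Strong subadditivity. -/

section StrongSubadditivity

variable {m n : Type*} [Fintype m] [DecidableEq m] [Fintype n] [DecidableEq n]

/-- Star homomorphisms commute with the functional calculus; the discontinuity of `Real.log` at 0 is
harmless because the spectrum is finite. -/
theorem matLog_map {φ : Matrix m m ℂ →⋆ₐ[ℝ] Matrix n n ℂ} {A : Matrix m m ℂ}
    (hA : A.IsHermitian) : φ (matLog A) = matLog (φ A) :=
  φ.map_cfc (S := ℝ) Real.log A ((finite_real_spectrum (A := A)).continuousOn _)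
    (LinearMap.continuous_of_finiteDimensional φ.toAlgHom.toLinearMap) hA.isSelfAdjoint
    (hA.isSelfAdjoint.map φ)

/-- The embedding `A ↦ 1 ⊗ A`. -/
noncomputable def oneKronecker (m : Type*) [Fintype m] [DecidableEq m] :
    Matrix n n ℂ →⋆ₐ[ℝ] Matrix (m × n) (m × n) ℂ where
  toFun A := (1 : Matrix m m ℂ) ⊗ₖ A
  map_one' := one_kronecker_one
  map_mul' A B := by rw [← mul_kronecker_mul, Matrix.one_mul]
  map_zero' := kronecker_zero _
  map_add' A B := kronecker_add _ _ _
  commutes' r := by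
    simp only [Algebra.algebraMap_eq_smul_one, kronecker_smul, one_kronecker_one]
  map_star' A := by
    simp only [star_eq_conjTranspose, conjTranspose_kronecker, conjTranspose_one]

/-- Relabelling the index set. -/
noncomputable def reindexStarAlgHom (e : m ≃ n) : Matrix m m ℂ →⋆ₐ[ℝ] Matrix n n ℂ where
  __ := (reindexAlgEquiv ℝ ℂ e : Matrix m m ℂ →ₐ[ℝ] Matrix n n ℂ)
  map_star' A := by
    ext i j
    simp [star_eq_conjTranspose]

theorem matLog_one_kronecker {A : Matrix n n ℂ} (hA : A.IsHermitian) :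
    matLog ((1 : Matrix m m ℂ) ⊗ₖ A) = (1 : Matrix m m ℂ) ⊗ₖ matLog A :=
  (matLog_map (φ := oneKronecker m) hA).symm

theorem matLog_reindex (e : m ≃ n) {A : Matrix m m ℂ} (hA : A.IsHermitian) :
    matLog (A.reindex e e) = (matLog A).reindex e e :=
  (matLog_map (φ := reindexStarAlgHom e) hA).symm

omit [DecidableEq m] [DecidableEq n] in
theorem trace_reindex_mul_reindex (e : m ≃ n) (A B : Matrix m m ℂ) :
    (A.reindex e e * B.reindex e e).trace = (A * B).trace := by
  simp only [reindex_apply, submatrix_mul_equiv, trace, diag, submatrix_apply]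
  exact e.symm.sum_comp fun i => (A * B) i i

theorem relEntropy_reindex (e : m ≃ n) {A B : Matrix m m ℂ} (hA : A.IsHermitian)
    (hB : B.IsHermitian) : relEntropy (A.reindex e e) (B.reindex e e) = relEntropy A B := by
  simp only [relEntropy, matLog_reindex e hA, matLog_reindex e hB, trace_sub,
    trace_reindex_mul_reindex]

omit [DecidableEq m] [DecidableEq n] in
theorem kerLE_reindex (e : m ≃ n) {γ ρ : Matrix m m ℂ} (h : KerLE γ ρ) :
    KerLE (γ.reindex e e) (ρ.reindex e e) := by
  have key : ∀ (M : Matrix m m ℂ) (v : n → ℂ), M.reindex e e *ᵥ v = (M *ᵥ (v ∘ e)) ∘ e.symm := by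
    intro M v
    rw [reindex_apply, submatrix_mulVec_equiv, Equiv.symm_symm]
  intro v hv
  have hv' : (γ *ᵥ (v ∘ e)) ∘ e.symm = 0 := (key γ v).symm.trans hv
  change ρ.reindex e e *ᵥ v = 0
  rw [key, h.mulVec_eq_zero (v := v ∘ e)]
  · rfl
  · ext i
    simpa using congrFun hv' (e i)

theorem relEntropy_one_kronecker_traceLeft {ρ : Matrix (m × n) (m × n) ℂ} (hρ : ρ.PosSemidef) :
    relEntropy ρ ((1 : Matrix m m ℂ) ⊗ₖ traceLeft ρ) = entropy (traceLeft ρ) - entropy ρ := by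
  rw [relEntropy, entropy, entropy, matLog_one_kronecker (posSemidef_traceLeft hρ).isHermitian,
    trace_sub, trace_mul_comm ρ (_ ⊗ₖ _), ← trace_mul_traceLeft,
    trace_mul_comm (traceLeft ρ), Complex.sub_re]
  ring

-- A kernel vector has every slice `v (k, ·)` in the kernel of the partial trace, so `ρ` kills each
-- `e_k ⊗ v (k, ·)`, and these sum to `v`.
omit [DecidableEq n] in
theorem kerLE_one_kronecker_traceLeft {ρ : Matrix (m × n) (m × n) ℂ} (hρ : ρ.PosSemidef) :
    KerLE ((1 : Matrix m m ℂ) ⊗ₖ traceLeft ρ) ρ := by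
  intro v hv
  have hv' : ((1 : Matrix m m ℂ) ⊗ₖ traceLeft ρ) *ᵥ v = 0 := hv
  have hk : ∀ k, traceLeft ρ *ᵥ (fun j => v (k, j)) = 0 := by
    intro k
    ext i
    have := congrFun hv' (k, i)
    simpa [mulVec, dotProduct, Fintype.sum_prod_type, one_apply, ite_mul] using this
  -- Swapping the factors reduces to the right partial trace.
  have hρ' := hρ.submatrix (Equiv.prodComm n m)
  have ht : traceRight (ρ.submatrix (Equiv.prodComm n m) (Equiv.prodComm n m)) = traceLeft ρ := rfl
  have hz := fun k => mulVec_tensorBasis_eq_zero hρ' (ht.symm ▸ hk k) k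
  change ρ *ᵥ v = 0
  ext p
  have hp : ∀ k, ∑ i, ρ p (k, i) * v (k, i) = 0 := by
    intro k
    have := congrFun (hz k) p.swap
    rw [mulVec_tensorBasis] at this
    simpa using this
  simp only [mulVec, dotProduct, Fintype.sum_prod_type, hp, Finset.sum_const_zero, Pi.zero_apply]

/-- Strong subadditivity of the von Neumann entropy. -/
theorem entropy_add_entropy_le {l : Type*} [Fintype l] [DecidableEq l]
    {ρ : Matrix (l × m × n) (l × m × n) ℂ} (hρ : ρ.PosSemidef) :
    entropy ρ + entropy (traceRight (traceLeft ρ)) ≤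
      entropy (traceThird ρ) + entropy (traceLeft ρ) := by
  set e := (Equiv.prodAssoc l m n).symm
  set γ := (1 : Matrix l l ℂ) ⊗ₖ traceLeft ρ with hγ
  have hγp : γ.PosSemidef := PosSemidef.one.kronecker (posSemidef_traceLeft hρ)
  have h₁ : traceRight (γ.reindex e e) = (1 : Matrix l l ℂ) ⊗ₖ traceLeft (traceThird ρ) := by
    ext ⟨i, j⟩ ⟨i', j'⟩
    change ∑ x, (1 : Matrix l l ℂ) i i' * ∑ y, ρ (y, j, x) (y, j', x) =
      (1 : Matrix l l ℂ) i i' * ∑ y, ∑ x, ρ (y, j, x) (y, j', x)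
    rw [← Finset.mul_sum, Finset.sum_comm]
  have h₂ : traceLeft (traceThird ρ) = traceRight (traceLeft ρ) := by
    ext i j
    simp only [traceRight, traceLeft, traceThird, of_apply, reindex_apply, submatrix_apply,
      Equiv.symm_symm, Equiv.prodAssoc_apply]
    exact Finset.sum_comm
  have hρe : (ρ.reindex e e).PosSemidef := hρ.submatrix _
  have hγe : (γ.reindex e e).PosSemidef := hγp.submatrix _
  have hle := relEntropy_traceRight_le hρe hγe
    (kerLE_reindex e (kerLE_one_kronecker_traceLeft hρ))
  rw [relEntropy_reindex e hρ.isHermitian hγp.isHermitian, h₁,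
    relEntropy_one_kronecker_traceLeft hρ] at hle
  have := relEntropy_one_kronecker_traceLeft (posSemidef_traceRight hρe)
  change relEntropy _ ((1 : Matrix l l ℂ) ⊗ₖ traceLeft (traceThird ρ)) =
    entropy (traceLeft (traceThird ρ)) - entropy (traceThird ρ) at this
  rw [this, h₂] at hle
  linarith

end StrongSubadditivity

/-! ### Weyl–Heisenberg twirling. -/

section Twirl

theorem star_exp_mul_exp (d : ℕ) :
    star (Complex.exp (2 * Real.pi * Complex.I / d)) *
      Complex.exp (2 * Real.pi * Complex.I / d) = 1 := by
  rw [Complex.star_def, ← Complex.exp_conj, ← Complex.exp_add]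
  simp [Complex.conj_ofReal, neg_div, Complex.conj_ofNat]

theorem weylZ_pow (d n : ℕ) : weylZ d ^ n =
    diagonal fun j : Fin d => Complex.exp (2 * Real.pi * Complex.I / d) ^ ((j : ℕ) * n) := by
  rw [weylZ, diagonal_pow]
  congr 1
  ext j
  rw [Pi.pow_apply, pow_mul]

theorem weylX_pow_apply {d : ℕ} (m : ℕ) (j k : Fin d) :
    (weylX d ^ m) j k = if ((j : ℕ) + m) % d = k then 1 else 0 := by
  induction m generalizing j with
  | zero => simp [one_apply, Nat.mod_eq_of_lt j.2, Fin.ext_iff]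
  | succ m ih =>
    have hd : 0 < d := j.pos
    rw [pow_succ', mul_apply, Finset.sum_eq_single ⟨(j + 1) % d, Nat.mod_lt _ hd⟩]
    · rw [ih, Nat.mod_add_mod, add_assoc, add_comm 1 m, weylX, of_apply, if_pos rfl, one_mul]
    · intro b _ hb
      have : ¬ ((j : ℕ) + 1) % d = b := fun h => hb (Fin.ext h.symm)
      simp [weylX, this]
    · simp

theorem weylX_mem_unitaryGroup (d : ℕ) : weylX d ∈ unitaryGroup (Fin d) ℂ := by
  rw [mem_unitaryGroup_iff]
  ext j k
  have hd : 0 < d := j.pos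
  rw [mul_apply, Finset.sum_eq_single ⟨(j + 1) % d, Nat.mod_lt _ hd⟩]
  · have h : ((k : ℕ) + 1) % d = (j + 1) % d ↔ j = k := by
      rw [Fin.ext_iff]
      constructor
      · intro h
        have := Nat.ModEq.add_right_cancel' 1 (show (k : ℕ) + 1 ≡ j + 1 [MOD d] from h)
        rw [Nat.ModEq, Nat.mod_eq_of_lt k.2, Nat.mod_eq_of_lt j.2] at this
        exact this.symm
      · intro h
        rw [h]
    simp [weylX, one_apply, h]
  · intro b _ hb
    have : ¬ ((j : ℕ) + 1) % d = b := fun h => hb (Fin.ext h.symm)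
    simp [weylX, this]
  · simp

theorem weylZ_mem_unitaryGroup (d : ℕ) : weylZ d ∈ unitaryGroup (Fin d) ℂ := by
  rw [mem_unitaryGroup_iff', weylZ, star_eq_conjTranspose, diagonal_conjTranspose,
    diagonal_mul_diagonal, ← diagonal_one]
  congr 1
  ext j
  rw [Pi.star_apply, star_pow, ← mul_pow, star_exp_mul_exp, one_pow]

theorem weyl_mem_unitaryGroup (d m n : ℕ) :
    weylX d ^ m * weylZ d ^ n ∈ unitaryGroup (Fin d) ℂ :=
  mul_mem (pow_mem (weylX_mem_unitaryGroup d) m) (pow_mem (weylZ_mem_unitaryGroup d) n)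

theorem weyl_apply {d : ℕ} (m n : ℕ) (j k : Fin d) : (weylX d ^ m * weylZ d ^ n) j k =
    if ((j : ℕ) + m) % d = k then
      Complex.exp (2 * Real.pi * Complex.I / d) ^ ((k : ℕ) * n) else 0 := by
  rw [weylZ_pow, mul_diagonal, weylX_pow_apply, ite_mul, one_mul, zero_mul]

/-- The dependence on `n` is isolated as an `n`-th power, so that summing over `n` gives a geometric
series. -/
theorem weyl_conj_apply {d : ℕ} (m n : ℕ) (P : Matrix (Fin d) (Fin d) ℂ) (j k : Fin d) :
    (weylX d ^ m * weylZ d ^ n * P * (weylX d ^ m * weylZ d ^ n)ᴴ) j k =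
      (Complex.exp (2 * Real.pi * Complex.I / d) ^ ((j + m) % d) *
        star (Complex.exp (2 * Real.pi * Complex.I / d) ^ ((k + m) % d))) ^ n *
      P ⟨(j + m) % d, Nat.mod_lt _ j.pos⟩ ⟨(k + m) % d, Nat.mod_lt _ k.pos⟩ := by
  have key : ∀ (i l : Fin d), ((i : ℕ) + m) % d = l ↔ l = ⟨(i + m) % d, Nat.mod_lt _ i.pos⟩ :=
    fun i l => by rw [Fin.ext_iff, eq_comm]
  simp only [mul_apply (N := _ᴴ), mul_apply (N := P), conjTranspose_apply, weyl_apply, key,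
    ite_mul, zero_mul, apply_ite star, star_zero, mul_ite, mul_zero, Finset.sum_ite_eq',
    Finset.mem_univ, if_true, mul_pow, pow_mul, star_pow]
  ring

/-- Character orthogonality: the ratio is a `d`-th root of unity, and primitivity of ω makes it
differ from 1 when `j ≠ k`. -/
theorem sum_pow_root_mul_star {d : ℕ} (j k : Fin d) :
    ∑ n ∈ Finset.range d, (Complex.exp (2 * Real.pi * Complex.I / d) ^ (j : ℕ) *
      star (Complex.exp (2 * Real.pi * Complex.I / d) ^ (k : ℕ))) ^ n =
    if j = k then (d : ℂ) else 0 := by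
  set ω := Complex.exp (2 * Real.pi * Complex.I / d)
  have hω : IsPrimitiveRoot ω d := Complex.isPrimitiveRoot_exp d j.pos.ne'
  have h1 : star ω * ω = 1 := star_exp_mul_exp d
  have h1k : star (ω ^ (k : ℕ)) * ω ^ (k : ℕ) = 1 := by
    rw [star_pow, ← mul_pow, h1, one_pow]
  split_ifs with h
  · rw [h, mul_comm, h1k]
    simp
  · have hne : ω ^ (j : ℕ) * star (ω ^ (k : ℕ)) ≠ 1 := by
      intro h'
      refine h (Fin.ext (hω.pow_inj j.2 k.2 ?_))
      calc ω ^ (j : ℕ) = ω ^ (j : ℕ) * (star (ω ^ (k : ℕ)) * ω ^ (k : ℕ)) := by rw [h1k, mul_one]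
        _ = ω ^ (k : ℕ) := by rw [← mul_assoc, h', one_mul]
    rw [geom_sum_eq hne, mul_pow, ← star_pow, ← pow_mul, ← pow_mul, mul_comm (j : ℕ),
      mul_comm (k : ℕ), pow_mul, pow_mul, hω.pow_eq_one]
    simp

/-- Averaging over the Weyl–Heisenberg matrices. -/
theorem sum_weyl_conj (d : ℕ) (P : Matrix (Fin d) (Fin d) ℂ) :
    ∑ m ∈ Finset.range d, ∑ n ∈ Finset.range d,
      weylX d ^ m * weylZ d ^ n * P * (weylX d ^ m * weylZ d ^ n)ᴴ =
    ((d : ℂ) * P.trace) • (1 : Matrix (Fin d) (Fin d) ℂ) := by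
  ext j k
  have hd : 0 < d := j.pos
  have : NeZero d := ⟨hd.ne'⟩
  simp only [Matrix.sum_apply, weyl_conj_apply, ← Finset.sum_mul]
  have hs := fun m => sum_pow_root_mul_star (⟨(j + m) % d, Nat.mod_lt _ hd⟩ : Fin d)
    ⟨(k + m) % d, Nat.mod_lt _ hd⟩
  simp only at hs
  simp only [hs]
  by_cases hjk : j = k
  · subst hjk
    simp only [if_true, ← Finset.mul_sum, Matrix.smul_apply, one_apply_eq, smul_eq_mul, mul_one]
    congr 1
    rw [Finset.sum_range, trace]
    -- As `m` runs over residues, so does `j + m`; addition in `Fin d` is already mod `d`.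
    exact Equiv.sum_comp (Equiv.addLeft j) fun i => P i i
  · rw [Matrix.smul_apply, one_apply_ne hjk, smul_zero]
    refine Finset.sum_eq_zero fun m _ => ?_
    rw [if_neg, zero_mul]
    intro h
    have := Nat.ModEq.add_right_cancel' m (show (j : ℕ) + m ≡ k + m [MOD d] from Fin.mk.inj h)
    rw [Nat.ModEq, Nat.mod_eq_of_lt k.2, Nat.mod_eq_of_lt j.2] at this
    exact hjk (Fin.ext this)

theorem zpow_neg_eq_conjTranspose {ι : Type*} [Fintype ι] [DecidableEq ι] {U : Matrix ι ι ℂ}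
    (hU : U ∈ unitaryGroup ι ℂ) (n : ℕ) : U ^ (-(n : ℤ)) = (U ^ n)ᴴ := by
  rw [zpow_neg_natCast]
  exact inv_eq_left_inv (mem_unitaryGroup_iff'.1 (pow_mem hU n))

theorem sum_weyl_zpow_conj (d : ℕ) (P : Matrix (Fin d) (Fin d) ℂ) :
    ∑ m ∈ Finset.range d, ∑ n ∈ Finset.range d,
      weylX d ^ m * weylZ d ^ n * P * weylZ d ^ (-(n : ℤ)) * weylX d ^ (-(m : ℤ)) =
    ((d : ℂ) * P.trace) • (1 : Matrix (Fin d) (Fin d) ℂ) := by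
  simp only [zpow_neg_eq_conjTranspose (weylX_mem_unitaryGroup d),
    zpow_neg_eq_conjTranspose (weylZ_mem_unitaryGroup d), ← sum_weyl_conj, conjTranspose_mul,
    Matrix.mul_assoc]

/-- Conjugation by `1 ⊗ W` acts on each block separately, reducing the partial twirl to the full
one; block traces are the entries of `traceRight P`. -/
theorem one_kronecker_conj_apply {l ι : Type*} [Fintype l] [DecidableEq l] [Fintype ι]
    (W : Matrix ι ι ℂ) (P : Matrix (l × ι) (l × ι) ℂ) (a b : l) (j k : ι) :
    (((1 : Matrix l l ℂ) ⊗ₖ W) * P * ((1 : Matrix l l ℂ) ⊗ₖ W)ᴴ) (a, j) (b, k) =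
      (W * P.submatrix (fun i => (a, i)) (fun i => (b, i)) * Wᴴ) j k := by
  rw [conjTranspose_kronecker, conjTranspose_one]
  simp only [mul_apply, kroneckerMap_apply, Fintype.sum_prod_type, one_apply, ite_mul, one_mul,
    zero_mul, submatrix_apply]
  simp [Finset.sum_ite_irrel]

theorem weylU_mem_unitaryGroup (l : Type*) [Fintype l] [DecidableEq l] (d m n : ℕ) :
    weylU l d m n ∈ unitaryGroup (l × Fin d) ℂ :=
  kronecker_mem_unitary (one_mem _) (weyl_mem_unitaryGroup d m n)

/-- Averaging over the matrices `1 ⊗ X^m Z^n`. -/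
theorem sum_weylU_conj {l : Type*} [Fintype l] [DecidableEq l] (d : ℕ)
    (P : Matrix (l × Fin d) (l × Fin d) ℂ) :
    ∑ m ∈ Finset.range d, ∑ n ∈ Finset.range d,
      weylU l d m n * P * (weylU l d m n)ᴴ =
    (d : ℂ) • (traceRight P ⊗ₖ (1 : Matrix (Fin d) (Fin d) ℂ)) := by
  ext ⟨a, j⟩ ⟨b, k⟩
  have h := congrFun (congrFun
    (sum_weyl_conj d (P.submatrix (fun i => (a, i)) (fun i => (b, i)))) j) k
  simp only [Matrix.sum_apply] at h ⊢
  simp only [weylU, one_kronecker_conj_apply, h]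
  simp [traceRight, trace, mul_assoc]

end Twirl

end QEntropy

open QEntropy in
theorem mainTheorem4
    {n₁ n₂ n₃ : Type*} [Fintype n₁] [DecidableEq n₁] [Fintype n₂] [DecidableEq n₂]
    [Fintype n₃] [DecidableEq n₃] :
    -- joint convexity of the relative entropy
    ConvexOn ℝ
      {p : Matrix n₁ n₁ ℂ × Matrix n₁ n₁ ℂ | p.1.PosSemidef ∧ p.2.PosSemidef ∧ KerLE p.2 p.1}
      (fun p => relEntropy p.1 p.2) ∧
    -- the Weyl-Heisenberg matrices are unitary, and the twirl over them is the (partial) trace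
    (∀ d : ℕ, 1 ≤ d →
      weylX d ∈ Matrix.unitaryGroup (Fin d) ℂ ∧
      weylZ d ∈ Matrix.unitaryGroup (Fin d) ℂ ∧
      (∀ P : Matrix (Fin d) (Fin d) ℂ,
        ∑ m ∈ Finset.range d, ∑ n ∈ Finset.range d,
            weylX d ^ m * weylZ d ^ n * P * weylZ d ^ (-(n : ℤ)) * weylX d ^ (-(m : ℤ)) =
          ((d : ℂ) * P.trace) • (1 : Matrix (Fin d) (Fin d) ℂ)) ∧
      (∀ m n : ℕ, weylU n₁ d m n ∈ Matrix.unitaryGroup (n₁ × Fin d) ℂ) ∧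
      (∀ P : Matrix (n₁ × Fin d) (n₁ × Fin d) ℂ,
        (1 / (d : ℂ) ^ 2) • ∑ m ∈ Finset.range d, ∑ n ∈ Finset.range d,
            weylU n₁ d m n * P * (weylU n₁ d m n).conjTranspose =
          (1 / (d : ℂ)) • (traceRight P ⊗ₖ (1 : Matrix (Fin d) (Fin d) ℂ)))) ∧
    -- monotonicity of the relative entropy under partial trace
    (∀ ρ γ : Matrix (n₁ × n₂) (n₁ × n₂) ℂ, IsDensity ρ → IsDensity γ → KerLE γ ρ →
      KerLE (traceRight γ) (traceRight ρ) ∧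
      relEntropy (traceRight ρ) (traceRight γ) ≤ relEntropy ρ γ) ∧
    -- strong subadditivity
    (∀ ρ : Matrix (n₁ × n₂ × n₃) (n₁ × n₂ × n₃) ℂ, IsDensity ρ →
      entropy ρ + entropy (traceRight (traceLeft ρ)) ≤
        entropy (traceThird ρ) + entropy (traceLeft ρ)) := by
  refine ⟨convexOn_relEntropy, fun d hd => ⟨weylX_mem_unitaryGroup d, weylZ_mem_unitaryGroup d,
    sum_weyl_zpow_conj d, weylU_mem_unitaryGroup n₁ d, fun P => ?_⟩,
    fun ρ γ hρ hγ h => ⟨kerLE_traceRight hγ.posSemidef h,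
      relEntropy_traceRight_le hρ.posSemidef hγ.posSemidef h⟩,
    fun ρ hρ => entropy_add_entropy_le hρ.posSemidef⟩
  have hd' : (d : ℂ) ≠ 0 := by exact_mod_cast Nat.one_le_iff_ne_zero.1 hd
  rw [sum_weylU_conj, smul_smul]
  congr 1
  field_simp
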